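/- An instance $\mathcal M=(\mathcal S,s_1,\mathcal A,p,V,g)$ of a Markov decision process with global rewards consists of a finite state space $\mathcal S$, a starting state $s_1\in\mathcal S$, finite action sets $\mathcal A_s$ ($s\in\mathcal S$), a transition law $p(\cdot\mid s,a)$ on $\mathcal S$ and a random outcome vector $V(s,a)\in[0,1]^K$ with mean $v(s,a)$ for each $s\in\mathcal S$, $a\in\mathcal A_s$, and a concave reward function $g:[0,1]^K\to[0,1]$. Suppose that $|g(u)-g(w)|\le L\|u-w\|$ for all $u,w\in[0,1]^K$, where $\|\cdot\|$ is a norm on $\mathbb R^K$ such that $\|w\|\le\|\mathbf 1_K\|$ for all $w\in[0,1]^K$ (for instance any $\ell_p$ norm), $\mathbf 1_K$ being the all-one vector. A policy is non-anticipatory if the (possibly randomized) choice of the action $a_t\in\mathcal A_{s_t}$ depends only on the current state $s_t$ and on the history $H_{t-1}=(s_q,a_q,V_q(s_q,a_q))_{q<t}$. Given $(s_t,a_t)$, the pair consisting of the next state $s_{t+1}$ and the outcome $V_t(s_t,a_t)$ is independent of $H_{t-1}$, with $s_{t+1}\sim p(\cdot\mid s_t,a_t)$ and with $V_t(s_t,a_t)$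 distributed as $V(s_t,a_t)$; the two may be arbitrarily correlated. Let $\bar V_{1:T}=\frac1T\sum_{t=1}^T V_t(s_t,a_t)$. For a stationary (possibly randomized) policy $\pi$ let $\Lambda(s'\mid\pi,s)$ be the number of steps after which the Markov chain on $\mathcal S$ induced by $\pi$ and started at $s$ is at $s'$ for the first time (so it is $0$ if $s=s'$). Suppose that $\mathcal M$ is communicating, that is, the diameter $D=\max_{s,s'\in\mathcal S}\min_{\pi}\mathbb E[\Lambda(s'\mid\pi,s)]$ is finite. Let $\mathrm{opt}(\mathsf P_{\mathcal M})$ be the maximum of $g\big(\sum_{s,a}v(s,a)x(s,a)\big)$ over all $x\ge 0$ with $\sum_{s,a}x(s,a)=1$ and $\sum_{a\in\mathcal A_s}x(s,a)=\sum_{s',a'}p(s\mid s',a')x(s',a')$ for all $s\in\mathcal S$. Then for every non-anticipatory policy and every $T\ge1$, $$\mathbb E\big[g(\bar V_{1:T})\big]\le \mathrm{opt}(\mathsf P_{\mathcal M})+\frac{2L\|\mathbf 1_K\|D}{T}.$$ -/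

import Mathlib

open MeasureTheory ProbabilityTheory
open scoped ENNReal

/-- A Markov decision process with global rewards: state space `S`, a set of actions `A s` for each
state `s`, outcome vectors in `[0,1]^K`.  `Set.Icc 0 1` in `Fin K → ℝ` is the cube `[0,1]^K`. -/
structure MDPwGR (S : Type*) (A : S → Type*) (K : ℕ) where
  /-- the starting state -/
  start : S
  /-- the transition kernel: `trans s a` is the law of the next state -/
  trans : (s : S) → A s → PMF S
  /-- `outcome s a` is the law of the random outcome vector of the pair `s, a` -/
  outcome : (s : S) → A s → Measure (Fin K → ℝ)
  outcome_prob : ∀ s a, IsProbabilityMeasure (outcome s a)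
  outcome_mem : ∀ s a, ∀ᵐ w ∂(outcome s a), w ∈ Set.Icc (0 : Fin K → ℝ) 1
  /-- the reward function; only its values on the cube matter -/
  g : (Fin K → ℝ) → ℝ
  g_mem : ∀ w ∈ Set.Icc (0 : Fin K → ℝ) 1, g w ∈ Set.Icc (0 : ℝ) 1
  g_concave : ConcaveOn ℝ (Set.Icc (0 : Fin K → ℝ) 1) g

/-- A stationary, possibly randomized, policy. -/
abbrev StationaryPolicy {S : Type*} (A : S → Type*) : Type _ := (s : S) → PMF (A s)

/-- A history of `t` rounds: the states, actions and outcome vectors of these rounds. -/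
abbrev History {S : Type*} (A : S → Type*) (K t : ℕ) : Type _ :=
  Fin t → (Σ s, A s) × (Fin K → ℝ)

/-- A non-anticipatory, possibly randomized, policy: the law of the action in round `t` is a
(measurable) function of the history of the previous `t` rounds and of the current state. -/
structure Policy {S : Type*} [MeasurableSpace S] (A : S → Type*) [∀ s, MeasurableSpace (A s)]
    (K : ℕ) where
  act : (t : ℕ) → History A K t → (s : S) → PMF (A s)
  measurable_act : ∀ (t : ℕ) (s : S) (a : A s), Measurable fun h : History A K t => act t h s a

namespace MDPwGR

noncomputable section

variable {S : Type*} {A : S → Type*} {K : ℕ}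

/-- The mean outcome vector `v(s, a)`. -/
def mean (M : MDPwGR S A K) (s : S) (a : A s) : Fin K → ℝ :=
  fun k => ∫ w, w k ∂(M.outcome s a)

/-! ### The diameter -/

/-- Law of the next state from `s` under the stationary policy `π`. -/
def chainStep (M : MDPwGR S A K) (π : StationaryPolicy A) (s : S) : PMF S :=
  (π s).bind (M.trans s)

/-- The transition kernel of the Markov chain induced by a stationary policy, reading the current
state off the path up to time `n`. -/
def chainKernel [Countable S] [MeasurableSpace S] [MeasurableSingletonClass S]
    (M : MDPwGR S A K) (π : StationaryPolicy A) (n : ℕ) :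
    Kernel ((_ : Finset.Iic n) → S) S :=
  (Kernel.ofFunOfCountable fun s => (M.chainStep π s).toMeasure).comap
    (fun h => h ⟨n, Finset.mem_Iic.2 le_rfl⟩) (measurable_pi_apply _)

instance [Countable S] [MeasurableSpace S] [MeasurableSingletonClass S]
    (M : MDPwGR S A K) (π : StationaryPolicy A) (n : ℕ) :
    IsMarkovKernel (M.chainKernel π n) :=
  ⟨fun h => by
    rw [chainKernel, Kernel.comap_apply]
    exact PMF.toMeasure.isProbabilityMeasure _⟩

/-- Law of the path of the Markov chain induced by a stationary policy, started at `s`. -/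
def chainLaw [Countable S] [MeasurableSpace S] [MeasurableSingletonClass S]
    (M : MDPwGR S A K) (π : StationaryPolicy A) (s : S) : Measure (ℕ → S) :=
  Kernel.traj (X := fun _ => S) (M.chainKernel π) 0 (fun _ => s)

/-- The number of steps after which a path is at `s'` for the first time (`∞` if never). -/
def travelTime (s' : S) (path : ℕ → S) : ℝ≥0∞ :=
  ⨅ (t : ℕ) (_ : path t = s'), (t : ℝ≥0∞)

/-- The expected travel time from `s` to `s'` under a stationary policy. -/
def expectedTravelTime [Countable S] [MeasurableSpace S] [MeasurableSingletonClass S]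
    (M : MDPwGR S A K) (π : StationaryPolicy A) (s s' : S) : ℝ≥0∞ :=
  ∫⁻ path, travelTime s' path ∂(M.chainLaw π s)

/-- The diameter, as an extended nonnegative number. -/
def diameter [Countable S] [MeasurableSpace S] [MeasurableSingletonClass S]
    (M : MDPwGR S A K) : ℝ≥0∞ :=
  ⨆ (s : S) (s' : S), ⨅ π : StationaryPolicy A, M.expectedTravelTime π s s'

/-- The instance is communicating if its diameter is finite. -/
def Communicating [Countable S] [MeasurableSpace S] [MeasurableSingletonClass S]
    (M : MDPwGR S A K) : Prop :=
  M.diameter ≠ ∞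

/-! ### The offline benchmark -/

/-- The feasible region of the offline problem. -/
structure Feasible [Fintype S] [∀ s, Fintype (A s)] (M : MDPwGR S A K)
    (x : (s : S) → A s → ℝ) : Prop where
  balance : ∀ s, ∑ a, x s a = ∑ s', ∑ a', (M.trans s' a' s).toReal * x s' a'
  total : ∑ s, ∑ a, x s a = 1
  nonneg : ∀ s a, 0 ≤ x s a

/-- The objective of the offline problem. -/
def objective [Fintype S] [∀ s, Fintype (A s)] (M : MDPwGR S A K)
    (x : (s : S) → A s → ℝ) : ℝ :=
  M.g (∑ s, ∑ a, x s a • M.mean s a)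

/-- The optimal value of the offline problem. -/
def opt [Fintype S] [∀ s, Fintype (A s)] (M : MDPwGR S A K) : ℝ :=
  sSup (M.objective '' {x | M.Feasible x})

/-! ### The dynamics -/

/-- The history of the rounds `0, …, t - 1`. -/
def hist {Ω : Type*} (X : ℕ → Ω → Σ s, A s) (V : ℕ → Ω → Fin K → ℝ) (t : ℕ) (ω : Ω) :
    History A K t :=
  fun q => (X q ω, V q ω)

/-- `X t` is the state-action pair and `V t` the outcome vector of round `t` (rounds are numbered
from `0`) when the agent plays the policy `π`.

The next state and the outcome vector are jointly independent of the history, given the current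
state-action pair `x`: their conditional joint law is some `Q x` whose marginals are the transition
law and the outcome law of `x`; nothing else is required of the coupling `Q`. -/
structure IsRun [MeasurableSpace S] [∀ s, MeasurableSpace (A s)] (M : MDPwGR S A K)
    (π : Policy A K) {Ω : Type*} [MeasurableSpace Ω] (μ : Measure Ω)
    (X : ℕ → Ω → Σ s, A s) (V : ℕ → Ω → Fin K → ℝ) : Prop where
  measurable_X : ∀ t, Measurable (X t)
  measurable_V : ∀ t, Measurable (V t)
  start : ∀ᵐ ω ∂μ, (X 0 ω).1 = M.start
  /-- given the history and the current state, the action is drawn from the policy -/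
  action : ∀ (t : ℕ) (B : Set (History A K t)), MeasurableSet B → ∀ (s : S) (a : A s),
    μ {ω | hist X V t ω ∈ B ∧ X t ω = ⟨s, a⟩} =
      ∫⁻ ω in {ω | hist X V t ω ∈ B ∧ (X t ω).1 = s}, π.act t (hist X V t ω) s a ∂μ
  step : ∀ t : ℕ, ∃ Q : (Σ s, A s) → Measure (S × (Fin K → ℝ)),
    (∀ x, (Q x).map Prod.fst = (M.trans x.1 x.2).toMeasure ∧
      (Q x).map Prod.snd = M.outcome x.1 x.2) ∧
    ∀ B : Set (History A K t), MeasurableSet B → ∀ (x : Σ s, A s),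
      ∀ C : Set (S × (Fin K → ℝ)), MeasurableSet C →
        μ {ω | hist X V t ω ∈ B ∧ X t ω = x ∧ ((X (t + 1) ω).1, V t ω) ∈ C} =
          μ {ω | hist X V t ω ∈ B ∧ X t ω = x} * Q x C

/-- The average of the outcome vectors of the first `T` rounds. -/
def avgOutcome {Ω : Type*} (V : ℕ → Ω → Fin K → ℝ) (T : ℕ) (ω : Ω) : Fin K → ℝ :=
  (T : ℝ)⁻¹ • ∑ t ∈ Finset.range T, V t ω

end

end MDPwGR

/-!
The bound holds along every run, because the argument uses the policy only through the expected
occupation numbers of its state-action pairs.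

By Jensen's inequality the expected reward is at most `g` of the mean of the average outcome, and
that mean is `∑ v(s, a) z(s, a) / T`, where `z(s, a)` is the expected number of rounds with the pair
`s, a` (`IsRun.integral_avgOutcome`).  The numbers `z` almost satisfy the balance equations of the
offline problem: the defect telescopes to the difference between the point mass at the starting
state and the law `ν` of the state after `T` rounds (`IsRun.sum_occupation`).

The defect is repaired by travelling back to the starting state.  For a stationary policy with
finite expected travel time from `s` to `s'`, the expected numbers of visits to state-action pairs
before the target is reached form a unit flow from `s` to `s'`, with total mass the expected travel
time (`exists_flow_of_expectedTravelTime_ne_top`).  Mixing these flows over `s ~ ν` gives `w` of mass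
at most `D + ε` such that `z + w` is balanced, so its normalization is feasible.  Normalizing moves
the objective vector by at most `2 ‖1‖ (D + ε) / T`, which costs `L` times as much in reward
(`reward_le_opt_add_of_balanced`); finally `ε` tends to `0`.
-/

namespace MDPwGR

variable {S : Type*} {A : S → Type*} {K : ℕ}

/-! ### First passage of the chain of a stationary policy -/

/-- The Markov property: conditionally on an event `B` of the first `n` steps, the next state is
drawn from the current one. -/
theorem chainLaw_step [Fintype S] [MeasurableSpace S] [MeasurableSingletonClass S]
    (M : MDPwGR S A K) (π : StationaryPolicy A) (s : S) (n : ℕ)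
    {B : Set ((_ : Finset.Iic n) → S)} (hB : MeasurableSet B) (r : S) :
    M.chainLaw π s {path | Preorder.frestrictLe n path ∈ B ∧ path (n + 1) = r} =
      ∑ q, M.chainLaw π s {path | Preorder.frestrictLe n path ∈ B ∧ path n = q} *
        M.chainStep π q r := by
  have hlast : Measurable fun h : (_ : Finset.Iic n) → S => h ⟨n, Finset.mem_Iic.2 le_rfl⟩ :=
    measurable_pi_apply _
  have h1 : M.chainLaw π s {path | Preorder.frestrictLe n path ∈ B ∧ path (n + 1) = r} =
      ((M.chainLaw π s).map fun path => (Preorder.frestrictLe n path, path (n + 1)))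
        (B ×ˢ {r}) := by
    rw [Measure.map_apply (by fun_prop) (hB.prod (measurableSet_singleton r))]
    rfl
  rw [h1, chainLaw, ← Kernel.partialTraj_compProd_eq_map_traj (Nat.zero_le n),
    Measure.compProd_apply_prod hB (measurableSet_singleton r),
    ← Kernel.traj_map_frestrictLe_apply]
  have h2 : ∀ h : (_ : Finset.Iic n) → S,
      M.chainKernel π n h {r} = M.chainStep π (h ⟨n, Finset.mem_Iic.2 le_rfl⟩) r := by
    intro h
    rw [chainKernel, Kernel.comap_apply]
    exact PMF.toMeasure_apply_singleton _ _ (measurableSet_singleton r)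
  simp only [h2]
  rw [← lintegral_map (f := fun q => M.chainStep π q r) (measurable_of_countable _) hlast,
    lintegral_fintype]
  refine Finset.sum_congr rfl fun q _ => ?_
  rw [Measure.map_apply hlast (measurableSet_singleton q),
    Measure.restrict_apply (hlast (measurableSet_singleton q)),
    Measure.map_apply (by fun_prop) ((hlast (measurableSet_singleton q)).inter hB), mul_comm]
  congr 2
  ext path
  exact and_comm

/-- The travel time counts the times `n` such that the path avoids the target up to time `n`. -/
theorem travelTime_eq_tsum (s' : S) (path : ℕ → S) :
    travelTime s' path =
      ∑' n : ℕ, {p : ℕ → S | ∀ k ≤ n, p k ≠ s'}.indicator (fun _ => (1 : ℝ≥0∞)) path := by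
  classical
  by_cases h : ∃ t, path t = s'
  · have h1 : travelTime s' path = (Nat.find h : ℝ≥0∞) := by
      refine le_antisymm
        (iInf₂_le (f := fun (t : ℕ) (_ : path t = s') => (t : ℝ≥0∞)) _ (Nat.find_spec h))
        (le_iInf₂ fun t ht => ?_)
      exact_mod_cast Nat.find_min' h ht
    rw [h1, tsum_eq_sum (s := Finset.range (Nat.find h)), Finset.sum_congr rfl
      (g := fun _ => (1 : ℝ≥0∞))]
    · simp
    · intro n hn
      refine Set.indicator_of_mem (fun k hk => ?_) _
      exact Nat.find_min h (lt_of_le_of_lt hk (Finset.mem_range.1 hn))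
    · intro n hn
      refine Set.indicator_of_notMem (fun hmem => ?_) _
      exact hmem _ (by simpa using hn) (Nat.find_spec h)
  · push Not at h
    have h1 : travelTime s' path = ∞ := by simp [travelTime, h]
    have h2 : ∀ n : ℕ, path ∈ {p : ℕ → S | ∀ k ≤ n, p k ≠ s'} := fun n k _ => h k
    simp [h1, h2]

/-- The probability that the chain is at `r` at time `n` and has not visited `s'` up to then. -/
noncomputable def avoidProb [Countable S] [MeasurableSpace S] [MeasurableSingletonClass S]
    (M : MDPwGR S A K) (π : StationaryPolicy A) (s s' : S) (n : ℕ) (r : S) : ℝ≥0∞ :=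
  M.chainLaw π s {path | (∀ k ≤ n, path k ≠ s') ∧ path n = r}

theorem _root_.PMF.sum_toReal {α : Type*} [Fintype α] (p : PMF α) : ∑ a, (p a).toReal = 1 := by
  rw [← ENNReal.toReal_sum fun a _ => p.apply_ne_top a, ← tsum_fintype (L := .unconditional _),
    p.tsum_coe, ENNReal.toReal_one]

theorem chainStep_toReal [∀ s, Fintype (A s)] (M : MDPwGR S A K) (π : StationaryPolicy A)
    (q r : S) : (M.chainStep π q r).toReal = ∑ a, (π q a).toReal * (M.trans q a r).toReal := by
  rw [chainStep, PMF.bind_apply, tsum_fintype, ENNReal.toReal_sum fun a _ =>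
    ENNReal.mul_ne_top ((π q).apply_ne_top a) ((M.trans q a).apply_ne_top r)]
  simp

theorem measurableSet_avoid [Countable S] [MeasurableSpace S] [MeasurableSingletonClass S]
    (s' : S) (n : ℕ) : MeasurableSet {path : ℕ → S | ∀ k ≤ n, path k ≠ s'} := by
  have : {path : ℕ → S | ∀ k ≤ n, path k ≠ s'} =
      ⋂ k ≤ n, (fun path : ℕ → S => path k) ⁻¹' {s'}ᶜ := by
    ext; simp
  rw [this]
  exact .iInter fun k => .iInter fun _ =>
    measurable_pi_apply k (measurableSet_singleton s').compl

section

variable [Fintype S] [MeasurableSpace S] [MeasurableSingletonClass S]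

theorem expectedTravelTime_eq_tsum (M : MDPwGR S A K) (π : StationaryPolicy A) (s s' : S) :
    M.expectedTravelTime π s s' = ∑ r, ∑' n, M.avoidProb π s s' n r := by
  rw [expectedTravelTime, ← Summable.tsum_finsetSum (fun _ _ => ENNReal.summable)]
  simp only [travelTime_eq_tsum]
  rw [lintegral_tsum fun n => (measurable_const.indicator (measurableSet_avoid s' n)).aemeasurable]
  refine tsum_congr fun n => ?_
  have hsum := sum_measure_preimage_singleton
    (μ := (M.chainLaw π s).restrict {path | ∀ k ≤ n, path k ≠ s'}) Finset.univ
    (f := fun path : ℕ → S => path n)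
    (fun r _ => measurable_pi_apply n (measurableSet_singleton r))
  rw [Finset.coe_univ, Set.preimage_univ, Measure.restrict_apply_univ] at hsum
  rw [lintegral_indicator_const (measurableSet_avoid s' n), one_mul, ← hsum]
  refine Finset.sum_congr rfl fun r _ => ?_
  rw [Measure.restrict_apply (measurable_pi_apply n (measurableSet_singleton r)), avoidProb]
  congr 1
  ext path
  exact and_comm

theorem avoidProb_zero [DecidableEq S] (M : MDPwGR S A K) (π : StationaryPolicy A) {s s' : S}
    (hs : s ≠ s') (r : S) : M.avoidProb π s s' 0 r = if r = s then 1 else 0 := by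
  have h0 : (M.chainLaw π s).map (Preorder.frestrictLe 0) = Measure.dirac fun _ => s := by
    rw [chainLaw, Kernel.traj_map_frestrictLe_apply, Kernel.partialTraj_self, Kernel.id_apply]
  have hlast : Measurable fun h : (_ : Finset.Iic 0) → S => h ⟨0, Finset.mem_Iic.2 le_rfl⟩ :=
    measurable_pi_apply _
  have hm : MeasurableSet {h : (_ : Finset.Iic 0) → S | h ⟨0, Finset.mem_Iic.2 le_rfl⟩ ≠ s' ∧
      h ⟨0, Finset.mem_Iic.2 le_rfl⟩ = r} :=
    hlast ((Set.toFinite {q | q ≠ s' ∧ q = r}).measurableSet)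
  have h1 : M.avoidProb π s s' 0 r = ((M.chainLaw π s).map (Preorder.frestrictLe 0))
      {h : (_ : Finset.Iic 0) → S | h ⟨0, Finset.mem_Iic.2 le_rfl⟩ ≠ s' ∧
        h ⟨0, Finset.mem_Iic.2 le_rfl⟩ = r} := by
    rw [Measure.map_apply (by fun_prop) hm, avoidProb]
    congr 1
    ext path
    simp
  rw [h1, h0, Measure.dirac_apply' _ hm]
  by_cases h : r = s
  · subst h
    simp [hs]
  · simp [h, Ne.symm h]

theorem avoidProb_succ (M : MDPwGR S A K) (π : StationaryPolicy A) (s : S) {s' r : S}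
    (hr : r ≠ s') (n : ℕ) :
    M.avoidProb π s s' (n + 1) r = ∑ q, M.avoidProb π s s' n q * M.chainStep π q r := by
  have hB : MeasurableSet {h : (_ : Finset.Iic n) → S | ∀ k, h k ≠ s'} :=
    (Set.toFinite _).measurableSet
  have key : ∀ path : ℕ → S, Preorder.frestrictLe n path ∈
      {h : (_ : Finset.Iic n) → S | ∀ k, h k ≠ s'} ↔ ∀ k ≤ n, path k ≠ s' := fun path => by
    simp [Preorder.frestrictLe]
  have := M.chainLaw_step π s n hB r
  simp only [key] at this
  simp only [avoidProb]
  rw [← this]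
  congr 1
  ext path
  simp only [Set.mem_ofPred_eq]
  constructor
  · rintro ⟨h, h'⟩
    exact ⟨fun k hk => h k (by omega), h'⟩
  · rintro ⟨h, h'⟩
    refine ⟨fun k hk => ?_, h'⟩
    rcases Nat.le_succ_iff.1 hk with hk | rfl
    · exact h k hk
    · exact h' ▸ hr

/-- The expected numbers of visits before the target is reached form a flow of unit strength from
`s` to `s'` whose total mass is the expected travel time. -/
theorem exists_flow_of_expectedTravelTime_ne_top [DecidableEq S] [∀ s, Fintype (A s)]
    (M : MDPwGR S A K) (π : StationaryPolicy A) (s s' : S)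
    (hfin : M.expectedTravelTime π s s' ≠ ∞) :
    ∃ y : (r : S) → A r → ℝ, (∀ r a, 0 ≤ y r a) ∧
      ∑ r, ∑ a, y r a ≤ (M.expectedTravelTime π s s').toReal ∧
      ∀ r, ∑ a, y r a = (∑ q, ∑ a, (M.trans q a r).toReal * y q a) +
        (if r = s then 1 else 0) - (if r = s' then 1 else 0) := by
  -- A chain started at the target has reached it at once: the empty flow does.
  rcases eq_or_ne s s' with rfl | hs
  · exact ⟨fun _ _ => 0, by simp, by simp, by simp⟩
  set Y : S → ℝ≥0∞ := fun r => ∑' n, M.avoidProb π s s' n r with hY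
  have htot : M.expectedTravelTime π s s' = ∑ r, Y r := M.expectedTravelTime_eq_tsum π s s'
  have hYfin : ∀ r, Y r ≠ ∞ := fun r =>
    ENNReal.sum_ne_top.1 (htot ▸ hfin) r (Finset.mem_univ r)
  have hYsucc : ∀ r, r ≠ s' →
      Y r = (if r = s then 1 else 0) + ∑ q, Y q * M.chainStep π q r := by
    intro r hr
    simp only [hY]
    rw [tsum_eq_zero_add' ENNReal.summable, M.avoidProb_zero π hs r]
    congr 1
    simp only [M.avoidProb_succ π s hr, ← ENNReal.tsum_mul_right]
    exact Summable.tsum_finsetSum fun _ _ => ENNReal.summable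
  set e : S → ℝ := fun r => (∑ q, (Y q).toReal * (M.chainStep π q r).toReal) +
    (if r = s then 1 else 0) - (if r = s' then 1 else 0) - (Y r).toReal with he
  have he_ne : ∀ r, r ≠ s' → e r = 0 := by
    intro r hr
    have hne : ∀ q ∈ Finset.univ, Y q * M.chainStep π q r ≠ ∞ := fun q _ =>
      ENNReal.mul_ne_top (hYfin q) (PMF.apply_ne_top _ _)
    have : (Y r).toReal = (if r = s then 1 else 0) +
        ∑ q, (Y q).toReal * (M.chainStep π q r).toReal := by
      rw [hYsucc r hr, ENNReal.toReal_add (by split_ifs <;> simp) (ENNReal.sum_ne_top.2 hne),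
        ENNReal.toReal_sum hne]
      congr 1
      · split_ifs <;> simp
      · simp
    simp only [he, this, if_neg hr]
    ring
  -- The balance at the target is not a first-step equation: it follows from the others, since
  -- the total defect vanishes.
  have he_sum : ∑ r, e r = 0 := by
    simp only [he, Finset.sum_sub_distrib, Finset.sum_add_distrib]
    rw [Finset.sum_comm]
    simp [← Finset.mul_sum, PMF.sum_toReal]
  have he_zero : ∀ r, e r = 0 := by
    intro r
    by_cases hr : r = s'
    · rw [hr, ← he_sum]
      exact (Finset.sum_eq_single s' (fun r _ hr => he_ne r hr) (by simp)).symm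
    · exact he_ne r hr
  refine ⟨fun r a => (Y r).toReal * (π r a).toReal, fun r a => by positivity, ?_, fun r => ?_⟩
  · rw [htot, ENNReal.toReal_sum fun r _ => hYfin r]
    simp [← Finset.mul_sum, PMF.sum_toReal]
  · have := he_zero r
    simp only [he, chainStep_toReal] at this
    rw [← Finset.mul_sum, PMF.sum_toReal, mul_one, ← sub_eq_zero.1 this]
    congr 2
    refine Finset.sum_congr rfl fun q _ => ?_
    rw [Finset.mul_sum]
    exact Finset.sum_congr rfl fun a _ => by ring

/-- In a communicating instance every state can be reached by a unit flow whose mass exceeds the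
diameter by as little as desired. -/
theorem Communicating.exists_flow [DecidableEq S] [∀ s, Fintype (A s)] {M : MDPwGR S A K}
    (hM : M.Communicating) (s s' : S) {ε : ℝ} (hε : 0 < ε) :
    ∃ y : (r : S) → A r → ℝ, (∀ r a, 0 ≤ y r a) ∧
      ∑ r, ∑ a, y r a ≤ M.diameter.toReal + ε ∧
      ∀ r, ∑ a, y r a = (∑ q, ∑ a, (M.trans q a r).toReal * y q a) +
        (if r = s then 1 else 0) - (if r = s' then 1 else 0) := by
  have hlt : ⨅ π : StationaryPolicy A, M.expectedTravelTime π s s' <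
      M.diameter + ENNReal.ofReal ε :=
    lt_of_le_of_lt (le_iSup₂ (f := fun s s' => ⨅ π, M.expectedTravelTime π s s') s s')
      (ENNReal.lt_add_right hM (by simpa using hε))
  obtain ⟨π, hπ⟩ := iInf_lt_iff.1 hlt
  obtain ⟨y, hy, hyle, hbal⟩ := M.exists_flow_of_expectedTravelTime_ne_top π s s' hπ.ne_top
  refine ⟨y, hy, hyle.trans ?_, hbal⟩
  have := ENNReal.toReal_mono (ENNReal.add_ne_top.2 ⟨hM, ENNReal.ofReal_ne_top⟩) hπ.le
  rwa [ENNReal.toReal_add hM ENNReal.ofReal_ne_top, ENNReal.toReal_ofReal hε.le] at this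

end

section

/-! ### The offline problem -/

theorem integrable_outcome (M : MDPwGR S A K) (s : S) (a : A s) :
    Integrable (fun w : Fin K → ℝ => w) (M.outcome s a) := by
  have := M.outcome_prob s a
  refine Integrable.of_bound measurable_id.aestronglyMeasurable 1 ?_
  filter_upwards [M.outcome_mem s a] with w hw
  refine (pi_norm_le_iff_of_nonneg zero_le_one).2 fun k => ?_
  rw [Real.norm_eq_abs, abs_le]
  exact ⟨by linarith [hw.1 k, show (0 : Fin K → ℝ) k = 0 from rfl], hw.2 k⟩

theorem integral_outcome (M : MDPwGR S A K) (s : S) (a : A s) :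
    ∫ w, w ∂(M.outcome s a) = M.mean s a := by
  ext k
  exact eval_integral (fun k => (M.integrable_outcome s a).eval k) k

theorem mean_mem (M : MDPwGR S A K) (s : S) (a : A s) :
    M.mean s a ∈ Set.Icc (0 : Fin K → ℝ) 1 := by
  have := M.outcome_prob s a
  rw [← integral_outcome]
  exact (convex_Icc _ _).integral_mem isClosed_Icc (M.outcome_mem s a) (M.integrable_outcome s a)

theorem continuousOn_g (M : MDPwGR S A K) (N : Seminorm ℝ (Fin K → ℝ)) (L : ℝ)
    (hL : ∀ u ∈ Set.Icc (0 : Fin K → ℝ) 1, ∀ w ∈ Set.Icc (0 : Fin K → ℝ) 1,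
      |M.g u - M.g w| ≤ L * N (u - w)) :
    ContinuousOn M.g (Set.Icc 0 1) := by
  have hN : Continuous N := continuousOn_univ.1 (N.convexOn.continuousOn isOpen_univ)
  intro u hu
  rw [ContinuousWithinAt, tendsto_iff_dist_tendsto_zero]
  have h0 : Filter.Tendsto (fun w => L * N (w - u)) (nhdsWithin u (Set.Icc 0 1)) (nhds 0) := by
    have : Continuous fun w => L * N (w - u) := by fun_prop
    simpa using (this.tendsto u).mono_left nhdsWithin_le_nhds
  refine squeeze_zero' (Filter.Eventually.of_forall fun _ => dist_nonneg) ?_ h0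
  filter_upwards [self_mem_nhdsWithin] with w hw
  exact hL w hw u hu

variable [Fintype S] [∀ s, Fintype (A s)]

theorem sum_smul_mean_mem (M : MDPwGR S A K) {x : (s : S) → A s → ℝ}
    (hx : ∀ s a, 0 ≤ x s a) (hsum : ∑ s, ∑ a, x s a = 1) :
    ∑ s, ∑ a, x s a • M.mean s a ∈ Set.Icc (0 : Fin K → ℝ) 1 := by
  rw [← Fintype.sum_sigma'] at hsum ⊢
  exact (convex_Icc _ _).sum_mem (fun i _ => hx _ _) hsum fun i _ => M.mean_mem _ _

theorem objective_le_opt (M : MDPwGR S A K) {x : (s : S) → A s → ℝ} (hx : M.Feasible x) :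
    M.objective x ≤ M.opt := by
  refine le_csSup ⟨1, ?_⟩ ⟨x, hx, rfl⟩
  rintro _ ⟨z, hz, rfl⟩
  exact (M.g_mem _ (M.sum_smul_mean_mem hz.nonneg hz.total)).2

/-- If occupation numbers `z` of total mass `T` become balanced after adding `w`, then the reward of
`z / T` exceeds the optimum by at most a term proportional to the mass of `w`: compare `z / T`
with the normalization of `z + w`. -/
theorem reward_le_opt_add_of_balanced (M : MDPwGR S A K) (N : Seminorm ℝ (Fin K → ℝ))
    (hcube : ∀ w ∈ Set.Icc (0 : Fin K → ℝ) 1, N w ≤ N 1) (L : ℝ)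
    (hL : ∀ u ∈ Set.Icc (0 : Fin K → ℝ) 1, ∀ w ∈ Set.Icc (0 : Fin K → ℝ) 1,
      |M.g u - M.g w| ≤ L * N (u - w))
    {z w : (s : S) → A s → ℝ} (hz : ∀ s a, 0 ≤ z s a) (hw : ∀ s a, 0 ≤ w s a)
    {T W : ℝ} (hT : 0 < T) (hzT : ∑ s, ∑ a, z s a = T) (hwW : ∑ s, ∑ a, w s a ≤ W)
    (hbal : ∀ s, ∑ a, (z s a + w s a) =
      ∑ s', ∑ a', (M.trans s' a' s).toReal * (z s' a' + w s' a')) :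
    M.g (T⁻¹ • ∑ s, ∑ a, z s a • M.mean s a) ≤ M.opt + 2 * L * N 1 * W / T := by
  set W' := ∑ s, ∑ a, w s a with hW'
  have hW'0 : 0 ≤ W' := Finset.sum_nonneg fun s _ => Finset.sum_nonneg fun a _ => hw s a
  have hTW : 0 < T + W' := by linarith
  set x : (s : S) → A s → ℝ := fun s a => (T + W')⁻¹ * (z s a + w s a) with hx
  have hfeas : M.Feasible x := by
    refine ⟨fun s => ?_, ?_, fun s a => mul_nonneg (by positivity) (add_nonneg (hz s a) (hw s a))⟩
    · simp only [hx, mul_left_comm _ (T + W')⁻¹, ← Finset.mul_sum, hbal]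
    · simp only [hx, ← Finset.mul_sum, Finset.sum_add_distrib, hzT, ← hW']
      exact inv_mul_cancel₀ hTW.ne'
  set u : Fin K → ℝ := T⁻¹ • ∑ s, ∑ a, z s a • M.mean s a with hu
  set b : Fin K → ℝ := ∑ s, ∑ a, w s a • M.mean s a with hb
  set u' : Fin K → ℝ := ∑ s, ∑ a, x s a • M.mean s a with hu'
  have hu_mem : u ∈ Set.Icc (0 : Fin K → ℝ) 1 := by
    have := M.sum_smul_mean_mem (x := fun s a => T⁻¹ * z s a)
      (fun s a => mul_nonneg (by positivity) (hz s a))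
      (by simp only [← Finset.mul_sum, hzT]; exact inv_mul_cancel₀ hT.ne')
    simpa only [mul_smul, ← Finset.smul_sum] using this
  have hu'_mem : u' ∈ Set.Icc (0 : Fin K → ℝ) 1 := M.sum_smul_mean_mem hfeas.nonneg hfeas.total
  have hu'_eq : u' = (T + W')⁻¹ • (T • u + b) := by
    simp only [hu', hx, hu, hb, mul_smul, add_smul, ← Finset.smul_sum, Finset.sum_add_distrib,
      smul_inv_smul₀ hT.ne']
  have hdiff : u - u' = (T + W')⁻¹ • (W' • u - b) := by
    rw [hu'_eq, eq_inv_smul_iff₀ hTW.ne', smul_sub, smul_inv_smul₀ hTW.ne', add_smul]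
    abel
  have hNb : N b ≤ W' * N 1 := by
    rw [hb, hW', Finset.sum_mul]
    refine (Finset.le_sum_of_subadditive N (map_zero N).le (map_add_le_add N) _ _).trans
      (Finset.sum_le_sum fun s _ => ?_)
    rw [Finset.sum_mul]
    refine (Finset.le_sum_of_subadditive N (map_zero N).le (map_add_le_add N) _ _).trans
      (Finset.sum_le_sum fun a _ => ?_)
    rw [map_smul_eq_mul, Real.norm_of_nonneg (hw s a)]
    exact mul_le_mul_of_nonneg_left (hcube _ (M.mean_mem s a)) (hw s a)
  have hN1 : 0 ≤ N 1 := apply_nonneg N 1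
  have hNdiff : N (u - u') ≤ 2 * N 1 * W / T := by
    have h1 : N (W' • u - b) ≤ 2 * N 1 * W' := by
      refine (map_sub_le_add N _ _).trans ?_
      rw [map_smul_eq_mul, Real.norm_of_nonneg hW'0]
      linarith [mul_le_mul_of_nonneg_left (hcube u hu_mem) hW'0]
    rw [hdiff, map_smul_eq_mul, Real.norm_of_nonneg (by positivity), inv_mul_eq_div]
    refine div_le_div₀ ?_ (h1.trans ?_) hT (by linarith)
    · exact mul_nonneg (by positivity) (hW'0.trans hwW)
    · exact mul_le_mul_of_nonneg_left hwW (by positivity)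
  -- `L` may be negative only if the cube is a point, and then `N` vanishes on it.
  have hLN : L * N (u - u') ≤ L * (2 * N 1 * W / T) := by
    rcases le_or_gt 0 L with h | h
    · exact mul_le_mul_of_nonneg_left hNdiff h
    · have h1 : 0 ≤ L * N 1 := by
        have := hL 1 ⟨zero_le_one, le_rfl⟩ 0 ⟨le_rfl, zero_le_one⟩
        rw [sub_zero] at this
        exact (abs_nonneg _).trans this
      have h2 : N 1 = 0 := le_antisymm (by nlinarith) hN1
      rw [h2] at hNdiff ⊢
      have h3 : N (u - u') = 0 := le_antisymm (by simpa using hNdiff) (apply_nonneg N _)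
      simp [h3]
  have hopt : M.g u' ≤ M.opt := M.objective_le_opt hfeas
  calc M.g u ≤ M.g u' + L * N (u - u') := by
        linarith [(le_abs_self _).trans (hL u hu_mem u' hu'_mem)]
    _ ≤ M.opt + L * (2 * N 1 * W / T) := add_le_add hopt hLN
    _ = _ := by ring

end

/-! ### Occupation probabilities of a run -/

theorem measurableSet_sigma_of_finite [Finite S] [∀ s, Finite (A s)]
    [∀ s, MeasurableSpace (A s)] [∀ s, MeasurableSingletonClass (A s)] (C : Set (Σ s, A s)) :
    MeasurableSet C :=
  MeasurableSpace.measurableSet_iInf.2 fun s =>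
    show MeasurableSet (Sigma.mk s ⁻¹' C) from (Set.toFinite _).measurableSet

namespace IsRun

variable [MeasurableSpace S] [∀ s, MeasurableSpace (A s)]
  {M : MDPwGR S A K} {π : Policy A K} {Ω : Type*} [MeasurableSpace Ω] {μ : Measure Ω}
  {X : ℕ → Ω → Σ s, A s} {V : ℕ → Ω → Fin K → ℝ}

theorem measureReal_state_zero [DecidableEq S] [IsProbabilityMeasure μ]
    (h : M.IsRun π μ X V) (s : S) :
    μ.real {ω | (X 0 ω).1 = s} = if s = M.start then 1 else 0 := by
  by_cases hs : s = M.start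
  · have : {ω | (X 0 ω).1 = s} =ᵐ[μ] Set.univ := by
      filter_upwards [h.start] with ω hω
      exact eq_true (hω.trans hs.symm)
    rw [measureReal_congr this, probReal_univ, if_pos hs]
  · have : {ω | (X 0 ω).1 = s} =ᵐ[μ] (∅ : Set Ω) := by
      filter_upwards [h.start] with ω hω
      exact eq_false fun h' => hs (h'.symm.trans hω)
    rw [measureReal_congr this, measureReal_empty, if_neg hs]

theorem measure_next_state [MeasurableSingletonClass S] (h : M.IsRun π μ X V) (t : ℕ)
    (x : Σ s, A s) (r : S) :
    μ {ω | X t ω = x ∧ (X (t + 1) ω).1 = r} = μ {ω | X t ω = x} * M.trans x.1 x.2 r := by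
  obtain ⟨Q, hQ, hstep⟩ := h.step t
  have := hstep Set.univ .univ x (Prod.fst ⁻¹' {r}) (measurable_fst (measurableSet_singleton r))
  rw [← Measure.map_apply measurable_fst (measurableSet_singleton r), (hQ x).1,
    PMF.toMeasure_apply_singleton _ _ (measurableSet_singleton r)] at this
  simpa using this

theorem map_outcome (h : M.IsRun π μ X V) (t : ℕ) (x : Σ s, A s) :
    (μ.restrict {ω | X t ω = x}).map (V t) = μ {ω | X t ω = x} • M.outcome x.1 x.2 := by
  obtain ⟨Q, hQ, hstep⟩ := h.step t
  ext C hC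
  have := hstep Set.univ .univ x (Prod.snd ⁻¹' C) (measurable_snd hC)
  rw [← Measure.map_apply measurable_snd hC, (hQ x).2] at this
  rw [Measure.map_apply (h.measurable_V t) hC,
    Measure.restrict_apply (h.measurable_V t hC), Measure.smul_apply, smul_eq_mul]
  simpa [Set.inter_def, and_comm] using this

variable [∀ s, MeasurableSingletonClass (A s)]

theorem measurableSet_X [Finite S] [∀ s, Finite (A s)] (h : M.IsRun π μ X V) (t : ℕ)
    (P : (Σ s, A s) → Prop) :
    MeasurableSet {ω | P (X t ω)} :=
  h.measurable_X t (measurableSet_sigma_of_finite {x | P x})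

variable [Fintype S] [∀ s, Fintype (A s)]

theorem ae_outcome_mem (h : M.IsRun π μ X V) (t : ℕ) :
    ∀ᵐ ω ∂μ, V t ω ∈ Set.Icc (0 : Fin K → ℝ) 1 := by
  have hx : ∀ x : Σ s, A s, ∀ᵐ ω ∂μ, X t ω = x → V t ω ∈ Set.Icc (0 : Fin K → ℝ) 1 := by
    intro x
    refine (ae_restrict_iff' (h.measurableSet_X t (· = x))).1 ?_
    refine ae_of_ae_map (h.measurable_V t).aemeasurable (p := (· ∈ Set.Icc (0 : Fin K → ℝ) 1)) ?_
    change ∀ᵐ w ∂((μ.restrict {ω | X t ω = x}).map (V t)), _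
    rw [h.map_outcome t x]
    exact Measure.ae_smul_measure (M.outcome_mem x.1 x.2) _
  filter_upwards [ae_all_iff.2 hx] with ω hω
  exact hω _ rfl

theorem ae_avgOutcome_mem (h : M.IsRun π μ X V) {T : ℕ} (hT : 1 ≤ T) :
    ∀ᵐ ω ∂μ, avgOutcome V T ω ∈ Set.Icc (0 : Fin K → ℝ) 1 := by
  filter_upwards [ae_all_iff.2 h.ae_outcome_mem] with ω hω
  have hT0 : (T : ℝ) ≠ 0 := by positivity
  rw [avgOutcome, Finset.smul_sum]
  exact (convex_Icc _ _).sum_mem (fun _ _ => by positivity) (by simp [hT0]) fun t _ => hω t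

variable [IsProbabilityMeasure μ]

theorem integrable_outcome (h : M.IsRun π μ X V) (t : ℕ) : Integrable (V t) μ := by
  refine Integrable.of_bound (h.measurable_V t).aestronglyMeasurable 1 ?_
  filter_upwards [h.ae_outcome_mem t] with ω hω
  refine (pi_norm_le_iff_of_nonneg zero_le_one).2 fun k => ?_
  rw [Real.norm_eq_abs, abs_le]
  exact ⟨by linarith [hω.1 k, show (0 : Fin K → ℝ) k = 0 from rfl], hω.2 k⟩

theorem integral_outcome (h : M.IsRun π μ X V) (t : ℕ) :
    ∫ ω, V t ω ∂μ = ∑ s, ∑ a, μ.real {ω | X t ω = ⟨s, a⟩} • M.mean s a := by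
  have hU : ⋃ x, {ω | X t ω = x} = Set.univ := by ext; simp
  rw [← setIntegral_univ, ← hU, integral_iUnion_fintype (fun x => h.measurableSet_X t (· = x))
    (fun x y hxy => Set.disjoint_left.2 fun ω hx hy => hxy (hx.symm.trans hy))
    (fun x => (h.integrable_outcome t).integrableOn), ← Fintype.sum_sigma']
  refine Finset.sum_congr rfl fun x _ => ?_
  rw [← MDPwGR.integral_outcome, measureReal_def, ← integral_smul_measure, ← h.map_outcome t x,
    integral_map (f := fun w => w) (h.measurable_V t).aemeasurable aestronglyMeasurable_id]

theorem sum_measureReal_pair (h : M.IsRun π μ X V) (t : ℕ) (s : S) :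
    ∑ a, μ.real {ω | X t ω = ⟨s, a⟩} = μ.real {ω | (X t ω).1 = s} := by
  rw [← measureReal_biUnion_finset
    (fun a _ b _ hab => Set.disjoint_left.2 fun ω ha hb =>
      hab (eq_of_heq (Sigma.mk.inj (ha.symm.trans hb)).2))
    (fun a _ => h.measurableSet_X t (· = ⟨s, a⟩))]
  congr 1
  ext ω
  simp only [Finset.mem_univ, Set.iUnion_true, Set.mem_iUnion, Set.mem_ofPred_eq]
  constructor
  · rintro ⟨a, ha⟩
    rw [ha]
  · rintro rfl
    exact ⟨(X t ω).2, rfl⟩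

theorem sum_measureReal_state (h : M.IsRun π μ X V) (t : ℕ) :
    ∑ s, μ.real {ω | (X t ω).1 = s} = 1 := by
  rw [← measureReal_biUnion_finset
    (fun a _ b _ hab => Set.disjoint_left.2 fun ω ha hb => hab (ha.symm.trans hb))
    (fun a _ => h.measurableSet_X t (·.1 = a))]
  convert! probReal_univ (μ := μ)
  ext ω
  simp

theorem measureReal_state_succ [MeasurableSingletonClass S] (h : M.IsRun π μ X V) (t : ℕ)
    (r : S) :
    μ.real {ω | (X (t + 1) ω).1 = r} =
      ∑ s, ∑ a, (M.trans s a r).toReal * μ.real {ω | X t ω = ⟨s, a⟩} := by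
  have hx : ∀ x : Σ s, A s, (M.trans x.1 x.2 r).toReal * μ.real {ω | X t ω = x} =
      μ.real {ω | X t ω = x ∧ (X (t + 1) ω).1 = r} := fun x => by
    rw [measureReal_def, measureReal_def, h.measure_next_state, ENNReal.toReal_mul, mul_comm]
  rw [← Fintype.sum_sigma' (f := fun s a => (M.trans s a r).toReal * μ.real {ω | X t ω = ⟨s, a⟩}),
    Finset.sum_congr rfl fun x _ => hx x, ← measureReal_biUnion_finset
    (f := fun x => {ω | X t ω = x ∧ (X (t + 1) ω).1 = r})
    (fun a _ b _ hab => Set.disjoint_left.2 fun ω ha hb => hab (ha.1.symm.trans hb.1))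
    (fun x _ => (h.measurableSet_X t (· = x)).inter (h.measurableSet_X (t + 1) (·.1 = r)))]
  congr 1
  ext ω
  simp

/-- The defect of balance of the expected occupation numbers telescopes: what enters a state but
does not leave it is the difference between the laws of the first and of the last state. -/
theorem sum_occupation [DecidableEq S] [MeasurableSingletonClass S] (h : M.IsRun π μ X V)
    (T : ℕ) (r : S) :
    ∑ a, ∑ t ∈ Finset.range T, μ.real {ω | X t ω = ⟨r, a⟩} =
      (∑ s, ∑ a, (M.trans s a r).toReal * ∑ t ∈ Finset.range T, μ.real {ω | X t ω = ⟨s, a⟩}) +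
        (if r = M.start then 1 else 0) - μ.real {ω | (X T ω).1 = r} := by
  have h1 : ∑ s, ∑ a, (M.trans s a r).toReal *
      ∑ t ∈ Finset.range T, μ.real {ω | X t ω = ⟨s, a⟩} =
      ∑ t ∈ Finset.range T, μ.real {ω | (X (t + 1) ω).1 = r} := by
    simp only [h.measureReal_state_succ, Finset.mul_sum]
    rw [Finset.sum_comm]
    exact Finset.sum_congr rfl fun s _ => Finset.sum_comm
  rw [h1, Finset.sum_comm]
  simp only [h.sum_measureReal_pair]
  rw [← h.measureReal_state_zero r,
    ← Finset.sum_range_succ' (fun t => μ.real {ω | (X t ω).1 = r}), Finset.sum_range_succ]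
  ring

theorem integrable_avgOutcome (h : M.IsRun π μ X V) (T : ℕ) : Integrable (avgOutcome V T) μ :=
  (integrable_finsetSum _ fun t _ => h.integrable_outcome t).smul (T : ℝ)⁻¹

theorem integral_avgOutcome (h : M.IsRun π μ X V) (T : ℕ) :
    ∫ ω, avgOutcome V T ω ∂μ = (T : ℝ)⁻¹ • ∑ s, ∑ a,
      (∑ t ∈ Finset.range T, μ.real {ω | X t ω = ⟨s, a⟩}) • M.mean s a := by
  simp only [avgOutcome]
  rw [integral_smul, integral_finsetSum _ fun t _ => h.integrable_outcome t]
  simp only [h.integral_outcome, Finset.sum_smul]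
  congr 1
  rw [Finset.sum_comm]
  exact Finset.sum_congr rfl fun s _ => Finset.sum_comm

theorem integrable_reward (h : M.IsRun π μ X V) (hg : ContinuousOn M.g (Set.Icc 0 1))
    {T : ℕ} (hT : 1 ≤ T) : Integrable (fun ω => M.g (avgOutcome V T ω)) μ := by
  have hmeas : Measurable ((Set.Icc (0 : Fin K → ℝ) 1).indicator M.g) := by
    classical
    rw [← Set.piecewise_eq_indicator]
    exact hg.measurable_piecewise continuousOn_const measurableSet_Icc
  have havg : Measurable (avgOutcome V T) := by
    have := h.measurable_V
    unfold avgOutcome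
    fun_prop
  have hae : (fun ω => (Set.Icc (0 : Fin K → ℝ) 1).indicator M.g (avgOutcome V T ω)) =ᵐ[μ]
      fun ω => M.g (avgOutcome V T ω) := by
    filter_upwards [h.ae_avgOutcome_mem hT] with ω hω
    exact Set.indicator_of_mem hω _
  refine Integrable.of_bound ((hmeas.comp havg).aestronglyMeasurable.congr hae) 1 ?_
  filter_upwards [h.ae_avgOutcome_mem hT] with ω hω
  have := M.g_mem _ hω
  rw [Real.norm_eq_abs, abs_le]
  exact ⟨by linarith [this.1], this.2⟩

end IsRun

end MDPwGR

/-! ### The upper bound -/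

theorem theorem1
    {S : Type*} [Fintype S] [MeasurableSpace S] [MeasurableSingletonClass S]
    {A : S → Type*} [∀ s, Fintype (A s)] [∀ s, MeasurableSpace (A s)]
    [∀ s, MeasurableSingletonClass (A s)] {K : ℕ}
    (M : MDPwGR S A K) (hM : M.Communicating)
    -- a norm on `ℝ^K` for which the all-one vector is longest in the cube
    (N : Seminorm ℝ (Fin K → ℝ)) (hN : ∀ w, N w = 0 → w = 0)
    (hcube : ∀ w ∈ Set.Icc (0 : Fin K → ℝ) 1, N w ≤ N 1)
    (L : ℝ)
    (hL : ∀ u ∈ Set.Icc (0 : Fin K → ℝ) 1, ∀ w ∈ Set.Icc (0 : Fin K → ℝ) 1,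
      |M.g u - M.g w| ≤ L * N (u - w))
    (π : Policy A K)
    {Ω : Type*} [MeasurableSpace Ω] (μ : Measure Ω) [IsProbabilityMeasure μ]
    (X : ℕ → Ω → Σ s, A s) (V : ℕ → Ω → Fin K → ℝ) (hrun : M.IsRun π μ X V)
    (T : ℕ) (hT : 1 ≤ T) :
    Integrable (fun ω => M.g (MDPwGR.avgOutcome V T ω)) μ ∧
      ∫ ω, M.g (MDPwGR.avgOutcome V T ω) ∂μ ≤
        M.opt + 2 * L * N 1 * M.diameter.toReal / T := by
  classical
  have hg := M.continuousOn_g N L hL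
  have hint := hrun.integrable_reward hg hT
  refine ⟨hint, le_of_forall_pos_le_add fun δ hδ => ?_⟩
  have hT0 : (0 : ℝ) < T := by exact_mod_cast hT
  -- The slack `ε` in the travel times costs `2 * L * N 1 * ε / T`, which has to be at most `δ`.
  obtain ⟨ε, hε, hεδ⟩ : ∃ ε : ℝ, 0 < ε ∧ 2 * L * N 1 / T * ε ≤ δ := by
    refine ⟨δ / (|2 * L * N 1 / T| + 1), by positivity, ?_⟩
    rw [mul_div_assoc', div_le_iff₀ (by positivity)]
    nlinarith [le_abs_self (2 * L * N 1 / T)]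
  choose y hy hyle hybal using fun s => hM.exists_flow s M.start hε
  set z : (s : S) → A s → ℝ :=
    fun s a => ∑ t ∈ Finset.range T, μ.real {ω | X t ω = ⟨s, a⟩} with hz
  -- The return flow: from the state after `T` rounds back to the starting state.
  set w : (s : S) → A s → ℝ := fun s a => ∑ q, μ.real {ω | (X T ω).1 = q} * y q s a with hw
  have hzT : ∑ s, ∑ a, z s a = T := by
    have : ∀ s, ∑ a, z s a = ∑ t ∈ Finset.range T, μ.real {ω | (X t ω).1 = s} := fun s => by
      rw [hz, Finset.sum_comm]
      simp only [hrun.sum_measureReal_pair]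
    simp only [this]
    rw [Finset.sum_comm]
    simp [hrun.sum_measureReal_state]
  have hwW : ∑ s, ∑ a, w s a ≤ M.diameter.toReal + ε := by
    have : ∑ s, ∑ a, w s a = ∑ q, μ.real {ω | (X T ω).1 = q} * ∑ s, ∑ a, y q s a := by
      simp only [hw, Finset.mul_sum]
      rw [Finset.sum_comm]
      exact Finset.sum_congr rfl fun s _ => Finset.sum_comm
    rw [this]
    calc _ ≤ ∑ q, μ.real {ω | (X T ω).1 = q} * (M.diameter.toReal + ε) :=
          Finset.sum_le_sum fun q _ => mul_le_mul_of_nonneg_left (hyle q) measureReal_nonneg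
      _ = _ := by rw [← Finset.sum_mul, hrun.sum_measureReal_state, one_mul]
  have hwbal : ∀ r, ∑ a, w r a = (∑ s, ∑ a, (M.trans s a r).toReal * w s a) +
      μ.real {ω | (X T ω).1 = r} - (if r = M.start then 1 else 0) := by
    intro r
    have h1 : ∑ a, w r a = ∑ q, μ.real {ω | (X T ω).1 = q} * ∑ a, y q r a := by
      simp only [hw, Finset.mul_sum]
      exact Finset.sum_comm
    have h2 : ∑ s, ∑ a, (M.trans s a r).toReal * w s a =
        ∑ q, μ.real {ω | (X T ω).1 = q} * ∑ s, ∑ a, (M.trans s a r).toReal * y q s a := by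
      simp only [hw, Finset.mul_sum, mul_left_comm _ (μ.real _)]
      rw [Finset.sum_comm]
      exact Finset.sum_congr rfl fun s _ => Finset.sum_comm
    rw [h1, h2]
    simp only [hybal, mul_sub, mul_add, Finset.sum_add_distrib, Finset.sum_sub_distrib]
    rw [← Finset.sum_mul, hrun.sum_measureReal_state]
    simp
  have hbound := M.reward_le_opt_add_of_balanced N hcube L hL (z := z) (w := w)
    (fun s a => Finset.sum_nonneg fun t _ => measureReal_nonneg)
    (fun s a => Finset.sum_nonneg fun q _ => mul_nonneg measureReal_nonneg (hy q s a))
    hT0 hzT hwW (fun r => by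
      simp only [mul_add, Finset.sum_add_distrib, hwbal]
      rw [hz, hrun.sum_occupation T r]
      ring)
  calc ∫ ω, M.g (MDPwGR.avgOutcome V T ω) ∂μ
      ≤ M.g (∫ ω, MDPwGR.avgOutcome V T ω ∂μ) :=
        M.g_concave.le_map_integral hg isClosed_Icc (hrun.ae_avgOutcome_mem hT)
          (hrun.integrable_avgOutcome T) hint
    _ ≤ M.opt + 2 * L * N 1 * (M.diameter.toReal + ε) / T := by
        rw [hrun.integral_avgOutcome]
        exact hbound
    _ = M.opt + 2 * L * N 1 * M.diameter.toReal / T + 2 * L * N 1 / T * ε := by ring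
    _ ≤ _ := by gcongr
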